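/- Definitions. Let $N$ be a set and let $\varphi$ be a formula of the language of set theory with free variables exactly $x_1,\dots,x_k$. The relativization $\varphi^N$ is obtained from $\varphi$ by restricting all quantifiers to $N$. The formula $\varphi$ is absolute for $N$ if $\varphi^N(a_1,\dots,a_k)\leftrightarrow\varphi(a_1,\dots,a_k)$ for all $a_1,\dots,a_k\in N$. For formulas $\varphi_1,\dots,\varphi_n$ and a countable set $Y$, the notation $M\prec(\varphi_1,\dots,\varphi_n;Y)$ ("$M$ is a suitable model for $\varphi_1,\dots,\varphi_n$ containing $Y$") means that $M\supset Y$ is a countable set for which $\varphi_1,\dots,\varphi_n$ are absolute. ("Countable" means finite or countably infinite.) A family $\mathcal F$ of separable linear subspaces of a real Banach space $X$ is called rich if (i) each separable linear subspace of $X$ is contained in an element of $\mathcal F$, and (ii) for every increasing sequence $F_1\subset F_2\subset\cdots$ in $\mathcal F$, the closure $\overline{\bigcup_{i=1}^\infty F_i}$ belongs to $\mathcal F$. Proposition. There exist a finite list of formulas $\varphi_1,\dots,\varphi_n$ of the language of set theory and a countable set $Y$ such that for every $M\prec(\varphi_1,\dots,\varphi_n;Y)$ the following holds: whenever $\langle X,+,\cdot,\|\cdot\|\rangle$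 is a real Banach space and $\mathcal F$ is a rich family of separable subspaces of $X$ with $\{X,+,\cdot,\|\cdot\|,\mathcal F\}\subset M$, then $X_M:=\overline{X\cap M}$ (the closure taken in $X$) belongs to $\mathcal F$. -/

import Mathlib

/-! The universe of sets is `ZFSet`; set-theoretic formulas are first-order formulas in the
language with one binary relation symbol, with variables indexed by `ℕ`. -/

universe u

namespace SuitableModels

open FirstOrder

/-- The only non-logical symbol of the language of set theory: the binary symbol `∈`. -/
inductive MemRel : ℕ → Type
  | mem : MemRel 2

/-- The language of set theory. -/
def setLang : Language := ⟨fun _ => Empty, MemRel⟩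

/-- The universe of sets as a structure for the language of set theory. -/
instance : setLang.Structure ZFSet.{u} where
  funMap := fun f => Empty.elim f
  RelMap := fun {_} r => match r with
    | MemRel.mem => fun xs => xs 0 ∈ xs 1

/-- Truth (in the universe of sets) of the relativization `φ^N` of a formula `φ` to `N`: the
quantifiers of `φ` range over the elements of `N` only. (In Mathlib's syntax `∃` is `¬ ∀ ¬`.) -/
def RelRealize (N : ZFSet.{u}) (v : ℕ → ZFSet.{u}) :
    ∀ {k : ℕ}, setLang.BoundedFormula ℕ k → (Fin k → ZFSet.{u}) → Prop
  | _, .falsum, _ => False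
  | _, .equal t₁ t₂, xs => t₁.realize (Sum.elim v xs) = t₂.realize (Sum.elim v xs)
  | _, .rel R ts, xs => Language.Structure.RelMap R fun i => (ts i).realize (Sum.elim v xs)
  | _, .imp φ ψ, xs => RelRealize N v φ xs → RelRealize N v ψ xs
  | _, .all φ, xs => ∀ x ∈ N, RelRealize N v φ (Fin.snoc xs x)

/-- The formula `φ` is absolute for `N`: for all values in `N` of the free variables of `φ`,
`φ^N` holds if and only if `φ` holds. -/
def IsAbsolute (φ : setLang.Formula ℕ) (N : ZFSet.{u}) : Prop :=
  ∀ v : ℕ → ZFSet.{u}, (∀ i ∈ φ.freeVarFinset, v i ∈ N) →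
    (RelRealize N v φ default ↔ φ.Realize v)

/-- `M` is a suitable model for the finite list of formulas `L` containing `Y`,
i.e. `M ≺ (L; Y)`. -/
structure IsSuitableModel (L : List (setLang.Formula ℕ)) (Y M : ZFSet.{u}) : Prop where
  subset : Y ⊆ M
  countable : (M : Set ZFSet.{u}).Countable
  absolute : ∀ φ ∈ L, IsAbsolute φ M

/-! ### Real numbers as sets -/

/-- The natural numbers as von Neumann ordinals. -/
noncomputable def natSet : ℕ → ZFSet.{u}
  | 0 => ∅
  | n + 1 => insert (natSet n) (natSet n)

/-- The integer `z` as the class of all pairs `(a, b)` of natural numbers with `a - b = z`. -/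
noncomputable def intSet (z : ℤ) : ZFSet.{u} :=
  ZFSet.range fun p : {p : ℕ × ℕ // (p.1 : ℤ) - (p.2 : ℤ) = z} =>
    ZFSet.pair (natSet p.1.1) (natSet p.1.2)

/-- The rational `q` as the class of all pairs `(a, b)` of integers with `b ≠ 0`, `a / b = q`. -/
noncomputable def ratSet (q : ℚ) : ZFSet.{u} :=
  ZFSet.range fun p : {p : ℤ × ℤ // p.2 ≠ 0 ∧ (p.1 : ℚ) / (p.2 : ℚ) = q} =>
    ZFSet.pair (intSet p.1.1) (intSet p.1.2)

/-- The real number `r` as the Dedekind cut `{q ∈ ℚ : q < r}`. -/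
noncomputable def realSet (r : ℝ) : ZFSet.{u} :=
  ZFSet.range fun q : {q : ℚ // (q : ℝ) < r} => ratSet q.1

/-! ### Banach spaces and families of subspaces as sets

The underlying set of the space is a set `X : ZFSet`; its operations and its norm are the
functions below, i.e. sets of ordered pairs. -/

section Codes

variable (X : ZFSet.{u}) [NormedAddCommGroup X] [NormedSpace ℝ X]

/-- The addition `+ : X × X → X` as a set. -/
noncomputable def addSet : ZFSet.{u} :=
  ZFSet.range fun p : X × X =>
    ZFSet.pair (ZFSet.pair (p.1 : ZFSet.{u}) p.2) ((p.1 + p.2 : X) : ZFSet.{u})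

/-- The scalar multiplication `· : ℝ × X → X` as a set. -/
noncomputable def smulSet : ZFSet.{u} :=
  ZFSet.range fun p : ℝ × X =>
    ZFSet.pair (ZFSet.pair (realSet p.1) (p.2 : ZFSet.{u})) ((p.1 • p.2 : X) : ZFSet.{u})

/-- The norm `‖·‖ : X → ℝ` as a set. -/
noncomputable def normSet : ZFSet.{u} :=
  ZFSet.range fun x : X => ZFSet.pair (x : ZFSet.{u}) (realSet ‖x‖)

variable {X}

/-- A subset of `X` as an element of the universe of sets. -/
noncomputable def subsetSet (A : Set X) : ZFSet.{u} :=
  ZFSet.range fun a : A => ((a : X) : ZFSet.{u})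

/-- A family of linear subspaces of `X` as an element of the universe of sets. -/
noncomputable def familySet (F : Set (Submodule ℝ X)) : ZFSet.{u} :=
  X.powerset.sep fun z => ∃ V ∈ F, z = subsetSet (V : Set X)

end Codes

/-- A family `F` of separable subspaces of a normed space `E` is rich if every separable subspace
of `E` is contained in an element of `F` and, for every increasing sequence in `F`, the closure
of its union belongs to `F`. -/
structure IsRichFamily {E : Type*} [NormedAddCommGroup E] [NormedSpace ℝ E]
    (F : Set (Submodule ℝ E)) : Prop where
  separable : ∀ V ∈ F, TopologicalSpace.IsSeparable (V : Set E)
  cofinal : ∀ W : Submodule ℝ E, TopologicalSpace.IsSeparable (W : Set E) → ∃ V ∈ F, W ≤ V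
  closure_iUnion_mem : ∀ V : ℕ → Submodule ℝ E, (∀ n, V n ∈ F) → Monotone V →
    ∃ W ∈ F, (W : Set E) = closure (⋃ n, (V n : Set E))

/-- The closure `X_M` of `X ∩ M` in `X`. -/
def closureInter (X M : ZFSet.{u}) [TopologicalSpace X] : Set X :=
  closure {x : X | (x : ZFSet.{u}) ∈ M}

end SuitableModels

namespace SuitableModels

open FirstOrder

/-! If `φ` and `∃ x, φ` are absolute for `M`, an existential statement true in the universe with
parameters in `M` has a witness in `M` (`IsAbsolute.exists_mem`). Two consequences carry the proof.
A separable set coded in `M` has an approximating enumeration in `M`; as `M` contains every natural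
number, it also contains values of that enumeration, so the set lies in `X_M`
(`subset_closureInter`). And any member of `F` coded in `M` can be enlarged, within `F` and `M`, to
contain a given point of `X ∩ M` (`exists_mem_family_ge`). Absorbing an enumeration of `X ∩ M` one
point at a time gives an increasing sequence in `F` whose union has closure `X_M`; richness puts
this closure in `F`. -/

/-! ### Relativization as truth in a substructure -/

/-- A set of sets as a structure for the language of set theory. -/
instance subtypeStructure (N : ZFSet.{u}) : setLang.Structure {x : ZFSet.{u} // x ∈ N} where
  funMap := fun f => Empty.elim f
  RelMap := fun {_} r => match r with
    | MemRel.mem => fun xs => (xs 0).1 ∈ (xs 1).1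

theorem coe_termRealize (N : ZFSet.{u}) {α : Type*} (t : setLang.Term α)
    (w : α → {x : ZFSet.{u} // x ∈ N}) :
    ((t.realize w : {x : ZFSet.{u} // x ∈ N}) : ZFSet.{u}) = t.realize fun i => (w i).1 := by
  cases t with
  | var i => rfl
  | func f ts => exact Empty.elim f

/-- This makes Mathlib's realization lemmas available for relativized formulas. -/
theorem relRealize_iff_realize (N : ZFSet.{u}) (v : ℕ → {x : ZFSet.{u} // x ∈ N}) {k : ℕ}
    (φ : setLang.BoundedFormula ℕ k) (xs : Fin k → {x : ZFSet.{u} // x ∈ N}) :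
    RelRealize N (fun i => (v i).1) φ (fun i => (xs i).1) ↔ φ.Realize v xs := by
  have helim : ∀ {k : ℕ} (xs : Fin k → {x : ZFSet.{u} // x ∈ N}),
      Sum.elim (fun i => (v i).1) (fun i => (xs i).1) = fun i => (Sum.elim v xs i).1 := by
    intro k xs
    funext i
    cases i <;> rfl
  induction φ with
  | falsum => rfl
  | equal t₁ t₂ =>
    simp only [RelRealize, Language.BoundedFormula.Realize, helim, ← coe_termRealize, Subtype.ext_iff]
  | rel R ts =>
    simp only [RelRealize, Language.BoundedFormula.Realize, helim, ← coe_termRealize]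
    cases R
    rfl
  | imp φ ψ ih₁ ih₂ =>
    simp only [RelRealize, Language.BoundedFormula.Realize, ih₁, ih₂]
  | all φ ih =>
    have hsnoc : ∀ x : {x : ZFSet.{u} // x ∈ N},
        (Fin.snoc (fun i => (xs i).1) x.1 : Fin _ → ZFSet.{u}) =
          fun i => ((Fin.snoc xs x : Fin _ → {x : ZFSet.{u} // x ∈ N}) i).1 := by
      intro x
      funext i
      refine Fin.lastCases ?_ (fun j => ?_) i <;> simp
    have hall : ∀ x : {x : ZFSet.{u} // x ∈ N},
        RelRealize N (fun i => (v i).1) φ (Fin.snoc (fun i => (xs i).1) x.1) ↔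
          φ.Realize v (Fin.snoc xs x) := by
      intro x
      rw [hsnoc]
      exact ih (Fin.snoc xs x)
    simp only [RelRealize, Language.BoundedFormula.Realize, ← hall]
    exact ⟨fun h x => h x.1 x.2, fun h x hx => h ⟨x, hx⟩⟩

theorem IsAbsolute.realize_iff {φ : setLang.Formula ℕ} {N : ZFSet.{u}} (h : IsAbsolute φ N)
    (v : ℕ → {x : ZFSet.{u} // x ∈ N}) : φ.Realize v ↔ φ.Realize fun i => (v i).1 := by
  rw [← h _ fun i _ => (v i).2, Language.Formula.Realize, ← relRealize_iff_realize]
  exact iff_of_eq (congrArg _ (Subsingleton.elim _ _))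

/-! ### Formulas with named variables -/

section Formulas

variable {S : Type*} [setLang.Structure S]

/-- The formula `x_i ∈ x_j`. -/
def memF (i j : ℕ) : setLang.Formula ℕ :=
  Language.Relations.formula₂ (L := setLang) MemRel.mem (Language.Term.var i) (Language.Term.var j)

/-- The formula `x_i = x_j`. -/
def eqF (i j : ℕ) : setLang.Formula ℕ :=
  Language.Term.equal (Language.Term.var i) (Language.Term.var j)

/-- The formula `∃ x_i, φ`. -/
def exF (i : ℕ) (φ : setLang.Formula ℕ) : setLang.Formula ℕ :=
  Language.BoundedFormula.ex (n := 0) (Language.BoundedFormula.relabel (n := 1) (k := 0)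
    (fun j => if j = i then Sum.inr 0 else Sum.inl j) φ)

/-- The formula `∀ x_i, φ`. -/
def allF (i : ℕ) (φ : setLang.Formula ℕ) : setLang.Formula ℕ := ∼ (exF i (∼ φ))

theorem realize_exF (i : ℕ) (φ : setLang.Formula ℕ) (v : ℕ → S) :
    (exF i φ).Realize v ↔ ∃ x, φ.Realize (Function.update v i x) := by
  rw [exF, Language.Formula.Realize, Language.BoundedFormula.realize_ex]
  refine exists_congr fun x => ?_
  rw [Language.BoundedFormula.realize_relabel, Language.Formula.Realize]
  refine iff_of_eq (congrArg₂ _ ?_ (Subsingleton.elim _ _))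
  funext j
  by_cases h : j = i
  · subst h
    simp [Fin.snoc]
  · simp [h]

theorem realize_allF (i : ℕ) (φ : setLang.Formula ℕ) (v : ℕ → S) :
    (allF i φ).Realize v ↔ ∀ x, φ.Realize (Function.update v i x) := by
  simp [allF, Language.Formula.realize_not, realize_exF]

theorem realize_eqF (i j : ℕ) (v : ℕ → S) : (eqF i j).Realize v ↔ v i = v j := by
  simp [eqF]

theorem realize_memF (i j : ℕ) (v : ℕ → ZFSet.{u}) : (memF i j).Realize v ↔ v i ∈ v j := by
  exact Language.Formula.realize_rel₂ (L := setLang) (R := MemRel.mem)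

end Formulas

/-- The formula `x_i ⊆ x_j`; it uses the variable `x_100`. -/
def subsetF (i j : ℕ) : setLang.Formula ℕ := allF 100 (memF 100 i ⟹ memF 100 j)

theorem realize_subsetF {i j : ℕ} (hi : i < 100) (hj : j < 100) (v : ℕ → ZFSet.{u}) :
    (subsetF i j).Realize v ↔ v i ⊆ v j := by
  simp only [subsetF, realize_allF, Language.Formula.realize_imp, realize_memF,
    Function.update_self, Function.update_of_ne hi.ne, Function.update_of_ne hj.ne]
  rfl

/-- The formula `x_k = (x_i, x_j)`; it uses the variables `x_101` and `x_102`. -/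
def pairF (i j k : ℕ) : setLang.Formula ℕ :=
  allF 101 (memF 101 k ⇔ (allF 102 (memF 102 101 ⇔ eqF 102 i) ⊔
    allF 102 (memF 102 101 ⇔ (eqF 102 i ⊔ eqF 102 j))))

theorem realize_pairF {i j k : ℕ} (hi : i < 101) (hj : j < 101) (hk : k < 101)
    (v : ℕ → ZFSet.{u}) : (pairF i j k).Realize v ↔ v k = ZFSet.pair (v i) (v j) := by
  have h₁ : i ≠ 102 := by omega
  have h₂ : j ≠ 102 := by omega
  have h₃ : (101 : ℕ) ≠ 102 := by omega
  simp only [pairF, realize_allF, Language.Formula.realize_iff, Language.Formula.realize_sup,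
    realize_memF, realize_eqF, Function.update_self, Function.update_of_ne h₁,
    Function.update_of_ne h₂, Function.update_of_ne h₃,
    Function.update_of_ne hi.ne, Function.update_of_ne hj.ne, Function.update_of_ne hk.ne]
  -- Kuratowski pairs: the elements of `(a, b)` are `{a}` and `{a, b}`.
  rw [ZFSet.ext_iff]
  refine forall_congr' fun z => ?_
  simp [ZFSet.pair, ZFSet.ext_iff (x := z)]

/-- The formula `(x_i, x_j) ∈ x_k`; it uses the variables `x_100`, `x_101` and `x_102`. -/
def pairMemF (i j k : ℕ) : setLang.Formula ℕ := exF 100 (pairF i j 100 ⊓ memF 100 k)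

theorem realize_pairMemF {i j k : ℕ} (hi : i < 100) (hj : j < 100) (hk : k < 100)
    (v : ℕ → ZFSet.{u}) : (pairMemF i j k).Realize v ↔ ZFSet.pair (v i) (v j) ∈ v k := by
  simp [pairMemF, realize_exF, Language.Formula.realize_inf, realize_memF,
    realize_pairF (hi.trans (Nat.lt_succ_self _)) (hj.trans (Nat.lt_succ_self _))
      (Nat.lt_succ_self 100), Function.update_of_ne hi.ne, Function.update_of_ne hj.ne,
    Function.update_of_ne hk.ne]

/-- If `φ` and `∃ x_0, φ` are absolute for `N`, then `N` contains witnesses for `∃ x_0, φ`. -/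
theorem IsAbsolute.exists_mem {φ : setLang.Formula ℕ} {N : ZFSet.{u}} (h : IsAbsolute φ N)
    (h' : IsAbsolute (exF 0 φ) N) (v : ℕ → ZFSet.{u}) (hv : ∀ i, v i ∈ N)
    (hex : ∃ x, φ.Realize (Function.update v 0 x)) :
    ∃ x ∈ N, φ.Realize (Function.update v 0 x) := by
  lift v to ℕ → {x : ZFSet.{u} // x ∈ N} using hv
  rw [← realize_exF] at hex
  -- Absoluteness of `∃ x_0, φ` descends to `N`; absoluteness of `φ` then carries the witness back
  -- up.
  obtain ⟨x, hx⟩ := (realize_exF 0 φ v).1 ((h'.realize_iff v).2 hex)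
  refine ⟨x.1, x.2, ?_⟩
  rw [h.realize_iff] at hx
  convert hx using 1
  funext i
  by_cases hi : i = 0
  · subst hi
    simp
  · simp [hi]

/-! ### Decoding numbers -/

theorem natSet_mem_natSet {m n : ℕ} (h : m < n) : natSet.{u} m ∈ natSet.{u} n := by
  induction n with
  | zero => omega
  | succ n ih =>
    rw [natSet, ZFSet.mem_insert_iff]
    rcases Nat.lt_succ_iff_lt_or_eq.1 h with h | rfl
    · exact Or.inr (ih h)
    · exact Or.inl rfl

theorem natSet_injective : Function.Injective natSet.{u} := by
  intro m n h
  by_contra hne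
  rcases Nat.lt_or_gt_of_ne hne with hlt | hlt
  · exact ZFSet.mem_irrefl _ (h ▸ natSet_mem_natSet hlt)
  · exact ZFSet.mem_irrefl _ (h ▸ natSet_mem_natSet hlt)

/-- The canonical pair of positive and negative parts lies in the class and determines the integer.
-/
theorem intSet_injective : Function.Injective intSet.{u} := by
  intro z w h
  have hz : ZFSet.pair (natSet z.toNat) (natSet (-z).toNat) ∈ intSet.{u} z :=
    ZFSet.mem_range.2 ⟨⟨(z.toNat, (-z).toNat), by simp⟩, rfl⟩
  rw [h, intSet, ZFSet.mem_range] at hz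
  obtain ⟨⟨⟨a, b⟩, hab⟩, he⟩ := hz
  obtain ⟨ha, hb⟩ := ZFSet.pair_inj.1 he
  have ha := natSet_injective ha
  have hb := natSet_injective hb
  dsimp only at ha hb hab
  omega

theorem ratSet_injective : Function.Injective ratSet.{u} := by
  intro q r h
  have hq : ZFSet.pair (intSet q.num) (intSet q.den) ∈ ratSet.{u} q :=
    ZFSet.mem_range.2 ⟨⟨(q.num, q.den), by simp, by simp [Rat.num_div_den]⟩, rfl⟩
  rw [h, ratSet, ZFSet.mem_range] at hq
  obtain ⟨⟨⟨a, b⟩, _, hab⟩, he⟩ := hq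
  obtain ⟨ha, hb⟩ := ZFSet.pair_inj.1 he
  have ha := intSet_injective ha
  have hb := intSet_injective hb
  dsimp only at ha hb hab
  rw [← hab, ha, hb, Int.cast_natCast, Rat.num_div_den]

/-- With Dedekind cuts the order of `ℝ` is inclusion, so formulas can compare norms without a code
for the order. -/
theorem realSet_subset_realSet {r s : ℝ} : realSet.{u} r ⊆ realSet.{u} s ↔ r ≤ s := by
  constructor
  · intro h
    by_contra! hlt
    obtain ⟨q, hsq, hqr⟩ := exists_rat_btwn hlt
    obtain ⟨p, hp⟩ := ZFSet.mem_range.1 (h (ZFSet.mem_range.2 ⟨⟨q, hqr⟩, rfl⟩))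
    exact (ratSet_injective hp ▸ p.2).not_gt hsq
  · intro h z hz
    obtain ⟨q, rfl⟩ := ZFSet.mem_range.1 hz
    exact ZFSet.mem_range.2 ⟨⟨q.1, q.2.trans_le h⟩, rfl⟩

/-! ### Decoding normed spaces -/

section Codes

variable {X : ZFSet.{u}}

theorem mem_subsetSet {A : Set X} {z : ZFSet.{u}} :
    z ∈ subsetSet A ↔ ∃ x ∈ A, z = x := by
  simp only [subsetSet, ZFSet.mem_range, Subtype.exists]
  grind

theorem coe_mem_subsetSet {A : Set X} {x : X} : (x : ZFSet.{u}) ∈ subsetSet A ↔ x ∈ A := by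
  rw [mem_subsetSet]
  constructor
  · rintro ⟨y, hy, h⟩
    rwa [Subtype.ext h]
  · exact fun h => ⟨x, h, rfl⟩

theorem subsetSet_subset_subsetSet {A B : Set X} : subsetSet A ⊆ subsetSet B ↔ A ⊆ B := by
  constructor
  · exact fun h x hx => coe_mem_subsetSet.1 (h (coe_mem_subsetSet.2 hx))
  · intro h z hz
    obtain ⟨x, hx, rfl⟩ := mem_subsetSet.1 hz
    exact coe_mem_subsetSet.2 (h hx)

variable [NormedAddCommGroup X]

theorem pair_mem_addSet {a b c : ZFSet.{u}} :
    ZFSet.pair (ZFSet.pair a b) c ∈ addSet X ↔ ∃ x y : X, a = x ∧ b = y ∧ c = (x + y : X) := by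
  simp only [addSet, ZFSet.mem_range, ZFSet.pair_inj, Prod.exists]
  grind

theorem pair_mem_normSet {a b : ZFSet.{u}} :
    ZFSet.pair a b ∈ normSet X ↔ ∃ x : X, a = x ∧ b = realSet ‖x‖ := by
  simp only [normSet, ZFSet.mem_range, ZFSet.pair_inj]
  grind

theorem mem_familySet [NormedSpace ℝ X] {F : Set (Submodule ℝ X)} {z : ZFSet.{u}} :
    z ∈ familySet F ↔ ∃ V ∈ F, z = subsetSet (V : Set X) := by
  rw [familySet, ZFSet.mem_sep, and_iff_right_iff_imp]
  rintro ⟨V, -, rfl⟩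
  rw [ZFSet.mem_powerset]
  intro z hz
  obtain ⟨x, -, rfl⟩ := mem_subsetSet.1 hz
  exact x.2

end Codes

/-! ### The suitable models for the proposition -/

/-- The set of natural numbers. -/
noncomputable def omegaSet : ZFSet.{u} := ZFSet.range natSet.{u}

/-- The set of the real numbers `1 / (n + 1)`. -/
noncomputable def radiiSet : ZFSet.{u} := ZFSet.range fun n : ℕ => realSet.{u} (1 / ((n : ℝ) + 1))

/-- The formula `x_0 ∈ x_1 ∧ x_2 ⊆ x_0 ∧ x_3 ∈ x_0`. -/
def enlargeF : setLang.Formula ℕ := memF 0 1 ⊓ subsetF 2 0 ⊓ memF 3 0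

/-- The formula saying that the relation `x_0` enumerates, with indices in `x_4`, points which
approximate each element of `x_1` up to each element of `x_5`, where `x_2` is the addition and
`x_3` is the norm. -/
def enumF : setLang.Formula ℕ :=
  allF 6 (memF 6 1 ⟹ allF 7 (memF 7 5 ⟹ exF 8 (memF 8 4 ⊓ (exF 9 (pairMemF 8 9 0) ⊓
    allF 9 (pairMemF 8 9 0 ⟹ exF 10 (exF 11 (exF 12 (pairF 10 9 11 ⊓ (pairMemF 11 6 2 ⊓
      (pairMemF 10 12 3 ⊓ subsetF 12 7))))))))))

theorem realize_enlargeF (v : ℕ → ZFSet.{u}) :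
    enlargeF.Realize v ↔ v 0 ∈ v 1 ∧ v 2 ⊆ v 0 ∧ v 3 ∈ v 0 := by
  simp [enlargeF, Language.Formula.realize_inf, realize_memF, realize_subsetF, and_assoc]

theorem realize_enumF (v : ℕ → ZFSet.{u}) :
    enumF.Realize v ↔ ∀ y ∈ v 1, ∀ ε ∈ v 5, ∃ n ∈ v 4, (∃ d, ZFSet.pair n d ∈ v 0) ∧
      ∀ d, ZFSet.pair n d ∈ v 0 → ∃ w r, ZFSet.pair (ZFSet.pair w d) y ∈ v 2 ∧
        ZFSet.pair w r ∈ v 3 ∧ r ⊆ ε := by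
  simp [enumF, Language.Formula.realize_inf, Language.Formula.realize_imp, realize_allF,
    realize_exF, realize_memF, realize_subsetF, realize_pairMemF, realize_pairF]

/-- The formulas whose absoluteness makes `closureInter X M` a member of each rich family. -/
def richFormulas : List (setLang.Formula ℕ) :=
  [memF 0 1, exF 0 (memF 0 1), enlargeF, exF 0 enlargeF, enumF, exF 0 enumF,
    pairMemF 1 0 2, exF 0 (pairMemF 1 0 2)]

/-- The parameters which make `closureInter X M` a member of each rich family. -/
noncomputable def richParameters : ZFSet.{u} := insert omegaSet (insert radiiSet omegaSet)

theorem countable_richParameters : (richParameters : Set ZFSet.{u}).Countable := by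
  have : (richParameters : Set ZFSet.{u}) ⊆ insert omegaSet (insert radiiSet (Set.range natSet)) := by
    intro z hz
    simpa [richParameters, omegaSet] using hz
  exact (((Set.countable_range _).insert _).insert _).mono this

/-- The values `a`, `b`, `c`, `d`, `e` for the variables `x_1`, ..., `x_5`. -/
def assign (a b c d e : ZFSet.{u}) : ℕ → ZFSet.{u}
  | 2 => b
  | 3 => c
  | 4 => d
  | 5 => e
  | _ => a

theorem assign_mem {N a b c d e : ZFSet.{u}} (ha : a ∈ N) (hb : b ∈ N) (hc : c ∈ N) (hd : d ∈ N)
    (he : e ∈ N) (i : ℕ) : assign a b c d e i ∈ N := by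
  unfold assign
  split <;> assumption


theorem IsSuitableModel.mem_natSet {L : List (setLang.Formula ℕ)} {M : ZFSet.{u}}
    (hM : IsSuitableModel L richParameters M) (n : ℕ) : natSet n ∈ M :=
  hM.subset (by simp [richParameters, omegaSet])

/-! ### Separable sets and rich families inside a suitable model -/

section

variable {M X : ZFSet.{u}} [NormedAddCommGroup X]

theorem IsSuitableModel.subset_closureInter
    (hM : IsSuitableModel richFormulas richParameters M) (hadd : addSet X ∈ M)
    (hnorm : normSet X ∈ M) {A : Set X} (hA : TopologicalSpace.IsSeparable A)
    (hAM : subsetSet A ∈ M) : A ⊆ closureInter X M := by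
  obtain ⟨c, hc, hAc⟩ := hA
  intro y hy
  -- The points `g n` need not lie in `A`; only `A ⊆ closure (range g)` is used.
  obtain ⟨g, rfl⟩ := hc.exists_eq_range (closure_nonempty_iff.1 ⟨y, hAc hy⟩)
  obtain ⟨e, heM, he⟩ := (hM.absolute enumF (by simp [richFormulas])).exists_mem
    (hM.absolute _ (by simp [richFormulas]))
    (assign (subsetSet A) (addSet X) (normSet X) omegaSet radiiSet)
    (assign_mem hAM hadd hnorm (hM.subset (by simp [richParameters]))
      (hM.subset (by simp [richParameters])))
    ⟨ZFSet.range fun n => ZFSet.pair (natSet n) (g n : ZFSet.{u}), by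
      rw [realize_enumF]
      intro y' hy' ε hε
      obtain ⟨y, hy, rfl⟩ := mem_subsetSet.1 hy'
      obtain ⟨k, rfl⟩ := ZFSet.mem_range.1 hε
      obtain ⟨_, ⟨n, rfl⟩, hn⟩ :=
        Metric.mem_closure_iff.1 (hAc hy) (1 / ((k : ℝ) + 1)) Nat.one_div_pos_of_nat
      refine ⟨natSet n, ZFSet.mem_range.2 ⟨n, rfl⟩, ⟨g n, ZFSet.mem_range.2 ⟨n, rfl⟩⟩,
        fun d hd => ?_⟩
      obtain ⟨m, hm⟩ := ZFSet.mem_range.1 hd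
      obtain ⟨hmn, rfl⟩ := ZFSet.pair_inj.1 hm
      obtain rfl := natSet_injective hmn
      refine ⟨(y - g m : X), realSet ‖y - g m‖, pair_mem_addSet.2 ⟨_, _, rfl, rfl, ?_⟩,
        pair_mem_normSet.2 ⟨_, rfl, rfl⟩, realSet_subset_realSet.2 ?_⟩
      · rw [sub_add_cancel]
      · rw [← dist_eq_norm]
        exact hn.le⟩
  rw [realize_enumF] at he
  refine Metric.mem_closure_iff.2 fun ε hε => ?_
  obtain ⟨k, hk⟩ := exists_nat_one_div_lt hε
  obtain ⟨n', hn', hdom, happrox⟩ :=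
    he y (coe_mem_subsetSet.2 hy) _ (ZFSet.mem_range.2 ⟨k, rfl⟩)
  obtain ⟨n, rfl⟩ := ZFSet.mem_range.1 hn'
  -- `e` need not be a function: every `d` related to `n` approximates `y`, so any such `d` in `M`
  -- will do.
  obtain ⟨d, hdM, hd⟩ := (hM.absolute (pairMemF 1 0 2) (by simp [richFormulas])).exists_mem
    (hM.absolute _ (by simp [richFormulas]))
    (assign (natSet n) e e e e) (assign_mem (hM.mem_natSet n) heM heM heM heM)
    (by simpa [realize_pairMemF, assign] using hdom)
  obtain ⟨w', r, hw, hr, hle⟩ := happrox d (by simpa [realize_pairMemF, assign] using hd)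
  -- The equation `w + x = y` expresses `w = y - x` through the code of addition.
  obtain ⟨w, x, rfl, rfl, hwx⟩ := pair_mem_addSet.1 hw
  obtain ⟨w₁, hw₁, rfl⟩ := pair_mem_normSet.1 hr
  obtain rfl := Subtype.ext hw₁
  refine ⟨x, hdM, ?_⟩
  rw [Subtype.ext hwx, dist_eq_norm, add_sub_cancel_right]
  exact (realSet_subset_realSet.1 hle).trans_lt hk

variable [NormedSpace ℝ X] {F : Set (Submodule ℝ X)}

theorem IsSuitableModel.exists_mem_family (hM : IsSuitableModel richFormulas richParameters M)
    (hF : IsRichFamily F) (hFM : familySet F ∈ M) : ∃ V ∈ F, subsetSet (V : Set X) ∈ M := by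
  obtain ⟨V, hV, -⟩ := hF.cofinal ⊥ (by simpa using (Set.finite_singleton (0 : X)).isSeparable)
  obtain ⟨z, hzM, hz⟩ := (hM.absolute (memF 0 1) (by simp [richFormulas])).exists_mem
    (hM.absolute _ (by simp [richFormulas])) (fun _ => familySet F) (fun _ => hFM)
    ⟨subsetSet (V : Set X), by simpa [realize_memF] using mem_familySet.2 ⟨V, hV, rfl⟩⟩
  obtain ⟨W, hW, rfl⟩ := mem_familySet.1 (by simpa [realize_memF] using hz)
  exact ⟨W, hW, hzM⟩

theorem IsSuitableModel.exists_mem_family_ge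
    (hM : IsSuitableModel richFormulas richParameters M) (hF : IsRichFamily F)
    (hFM : familySet F ∈ M) {V : Submodule ℝ X} (hV : V ∈ F) (hVM : subsetSet (V : Set X) ∈ M)
    {x : X} (hx : (x : ZFSet.{u}) ∈ M) :
    ∃ W ∈ F, subsetSet (W : Set X) ∈ M ∧ V ≤ W ∧ x ∈ W := by
  have hsep : TopologicalSpace.IsSeparable ((V ⊔ Submodule.span ℝ {x} : Submodule ℝ X) : Set X) := by
    rw [← Submodule.span_eq V, ← Submodule.span_union]
    exact ((hF.separable V hV).union (Set.finite_singleton x).isSeparable).span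
  obtain ⟨W, hW, hVW⟩ := hF.cofinal _ hsep
  rw [sup_le_iff, Submodule.span_singleton_le_iff_mem] at hVW
  -- `W` itself need not be coded in `M`; it only shows that the existential statement is true.
  obtain ⟨z, hzM, hz⟩ := (hM.absolute enlargeF (by simp [richFormulas])).exists_mem
    (hM.absolute _ (by simp [richFormulas]))
    (assign (familySet F) (subsetSet (V : Set X)) x x x) (assign_mem hFM hVM hx hx hx)
    ⟨subsetSet (W : Set X), (realize_enlargeF _).2 ⟨mem_familySet.2 ⟨W, hW, rfl⟩,
      subsetSet_subset_subsetSet.2 hVW.1, coe_mem_subsetSet.2 hVW.2⟩⟩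
  obtain ⟨hzF, hVz, hxz⟩ := (realize_enlargeF _).1 hz
  obtain ⟨W', hW', rfl⟩ := mem_familySet.1 hzF
  exact ⟨W', hW', hzM, subsetSet_subset_subsetSet.1 hVz, coe_mem_subsetSet.1 hxz⟩

theorem IsSuitableModel.closureInter_mem
    (hM : IsSuitableModel richFormulas richParameters M) (hF : IsRichFamily F)
    (hadd : addSet X ∈ M) (hnorm : normSet X ∈ M) (hFM : familySet F ∈ M) :
    ∃ V ∈ F, (V : Set X) = closureInter X M := by
  have hsub : ∀ V ∈ F, subsetSet (V : Set X) ∈ M → (V : Set X) ⊆ closureInter X M :=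
    fun V hV => hM.subset_closureInter hadd hnorm (hF.separable V hV)
  obtain ⟨V₀, hV₀, hV₀M⟩ := hM.exists_mem_family hF hFM
  have hcount : {x : X | (x : ZFSet.{u}) ∈ M}.Countable :=
    hM.countable.preimage Subtype.val_injective
  -- `X ∩ M` is nonempty because its closure contains `0 ∈ V₀`.
  obtain ⟨f, hf⟩ := hcount.exists_eq_range
    (closure_nonempty_iff.1 ⟨0, hsub V₀ hV₀ hV₀M V₀.zero_mem⟩)
  have hfM : ∀ n, (f n : ZFSet.{u}) ∈ M := fun n => hf.ge ⟨n, rfl⟩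
  have hstep : ∀ (V : {V : Submodule ℝ X // V ∈ F ∧ subsetSet (V : Set X) ∈ M}) (n : ℕ),
      ∃ W : {V : Submodule ℝ X // V ∈ F ∧ subsetSet (V : Set X) ∈ M},
        V.1 ≤ W.1 ∧ f n ∈ W.1 := by
    rintro ⟨V, hV, hVM⟩ n
    obtain ⟨W, hW, hWM, h⟩ := hM.exists_mem_family_ge hF hFM hV hVM (hfM n)
    exact ⟨⟨W, hW, hWM⟩, h⟩
  choose next hle hmem using hstep
  let V : ℕ → {V : Submodule ℝ X // V ∈ F ∧ subsetSet (V : Set X) ∈ M} :=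
    fun n => Nat.rec ⟨V₀, hV₀, hV₀M⟩ (fun n V => next V n) n
  obtain ⟨W, hW, hWV⟩ := hF.closure_iUnion_mem (fun n => (V n).1) (fun n => (V n).2.1)
    (monotone_nat_of_le_succ fun n => hle (V n) n)
  refine ⟨W, hW, hWV.trans (Set.Subset.antisymm ?_ ?_)⟩
  · exact closure_minimal (Set.iUnion_subset fun n => hsub _ (V n).2.1 (V n).2.2) isClosed_closure
  · refine closure_mono ?_
    rw [hf]
    rintro _ ⟨n, rfl⟩
    -- The point `f n` is absorbed in passing from `V n` to `V (n + 1)`.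
    exact Set.mem_iUnion.2 ⟨n + 1, hmem (V n) n⟩

end

end SuitableModels

theorem mainTheorem3 :
    ∃ (L : List (SuitableModels.setLang.Formula ℕ)) (Y : ZFSet.{u}),
      (Y : Set ZFSet.{u}).Countable ∧
      ∀ M : ZFSet.{u}, SuitableModels.IsSuitableModel L Y M →
        ∀ (X : ZFSet.{u}) [NormedAddCommGroup X] [NormedSpace ℝ X] [CompleteSpace X]
          (F : Set (Submodule ℝ X)), SuitableModels.IsRichFamily F →
          X ∈ M → SuitableModels.addSet X ∈ M → SuitableModels.smulSet X ∈ M →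
          SuitableModels.normSet X ∈ M → SuitableModels.familySet F ∈ M →
          ∃ V ∈ F, (V : Set X) = SuitableModels.closureInter X M :=
  ⟨SuitableModels.richFormulas, SuitableModels.richParameters,
    SuitableModels.countable_richParameters,
    fun _ hM _ _ _ _ _ hF _ hadd _ hnorm hFM => hM.closureInter_mem hF hadd hnorm hFM⟩
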